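/- Let $M$ be a smooth manifold with an almost hypercomplex structure $H=(J_1,J_2,J_3)$, i.e. $J_\alpha^2=-\mathrm{Id}$ and $J_\alpha=J_\beta\circ J_\gamma=-J_\gamma\circ J_\beta$ for all cyclic permutations $(\alpha,\beta,\gamma)$ of $(1,2,3)$, and a pseudo-Riemannian metric $g$ with $g(x,y)=g(J_1x,J_1y)=-g(J_2x,J_2y)=-g(J_3x,J_3y)$ (an almost $(H,G)$-manifold). Let $\nabla$ be the Levi-Civita connection of $g$ and $F_\alpha(x,y,z)=g((\nabla_xJ_\alpha)y,z)$. Assume that $M$ belongs to the class $\mathcal W_{133}$, that is, for all smooth vector fields $x,y,z$, $F_1(x,y,z)=-F_1(y,x,z)$ and $F_\alpha(x,y,z)+F_\alpha(y,z,x)+F_\alpha(z,x,y)=0$ for $\alpha=2,3$. Let $D$ be the pHKT-connection on $M$, i.e. the linear connection with $DJ_1=DJ_2=DJ_3=Dg=0$ whose torsion $T(x,y)=D_xy-D_yx-[x,y]$, $T(x,y,z)=g(T(x,y),z)$, is totally skew-symmetric (a 3-form). Then the following conditions are equivalent: (i) $D$ is strong: $\mathrm dT=0$; (ii) $D$ has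 $\nabla$-parallel torsion: $\nabla T=0$; (iii) $D$ is flat: its curvature tensor $K(x,y)z=D_xD_yz-D_yD_xz-D_{[x,y]}z$ vanishes. -/

import Mathlib

open scoped Manifold ContDiff Bundle

noncomputable section

namespace HGGeometry

variable (E : Type*) [NormedAddCommGroup E] [NormedSpace ℝ E]
  (M : Type*) [TopologicalSpace M] [ChartedSpace E M]
  [IsManifold 𝓘(ℝ, E) ∞ M]

/-- Vector fields on `M`, without any regularity. -/
abbrev VField : Type _ := Π p : M, TangentSpace 𝓘(ℝ, E) p

/-- Fields of endomorphisms of the tangent spaces, i.e. tensor fields of type `(1,1)`, without any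
regularity. -/
abbrev EndField : Type _ :=
  Π p : M, TangentSpace 𝓘(ℝ, E) p →L[ℝ] TangentSpace 𝓘(ℝ, E) p

/-- A linear connection on `M`: a covariant derivative on the tangent bundle. Mathlib's argument
order is nonstandard: `(∇_X Y)(p)` is written `∇ Y p (X p)`. -/
abbrev Connection : Type _ :=
  CovariantDerivative 𝓘(ℝ, E) E (TangentSpace 𝓘(ℝ, E) : M → Type _)

/-- A smooth pseudo-Riemannian metric on `M`. -/
structure PseudoMetric where
  /-- The bilinear form on each tangent space. -/
  val : Π p : M, TangentSpace 𝓘(ℝ, E) p →L[ℝ] TangentSpace 𝓘(ℝ, E) p →L[ℝ] ℝ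
  symm : ∀ p v w, val p v w = val p w v
  nondegenerate : ∀ p v, (∀ w, val p v w = 0) → v = 0
  contMDiff : ContMDiff 𝓘(ℝ, E) (𝓘(ℝ, E).prod 𝓘(ℝ, E →L[ℝ] E →L[ℝ] ℝ)) ∞
    (fun p ↦ Bundle.TotalSpace.mk' (E →L[ℝ] E →L[ℝ] ℝ)
      (E := fun p : M ↦ TangentSpace 𝓘(ℝ, E) p →L[ℝ] TangentSpace 𝓘(ℝ, E) p →L[ℝ] ℝ) p (val p))

/-- The signs `ε₁ = 1`, `ε₂ = ε₃ = -1` (the index `α : Fin 3` stands for `α + 1`). -/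
def sign : Fin 3 → ℝ := ![1, -1, -1]

/-- An almost `(H,G)`-structure on `M`: an almost hypercomplex structure `H = (J₁, J₂, J₃)`,
written `J 0, J 1, J 2`, and a pseudo-Riemannian metric `g` which is Hermitian with respect to
`J₁` and anti-Hermitian (Norden) with respect to `J₂` and `J₃`. The triples `(α, α + 1, α + 2)` in
`Fin 3` are the cyclic permutations. -/
structure AlmostHGStructure where
  /-- The almost complex structures. -/
  J : Fin 3 → EndField E M
  /-- The metric. -/
  g : PseudoMetric E M
  contMDiff_J : ∀ α, ContMDiff 𝓘(ℝ, E) (𝓘(ℝ, E).prod 𝓘(ℝ, E →L[ℝ] E)) ∞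
    (fun p ↦ Bundle.TotalSpace.mk' (E →L[ℝ] E)
      (E := fun p : M ↦ TangentSpace 𝓘(ℝ, E) p →L[ℝ] TangentSpace 𝓘(ℝ, E) p) p (J α p))
  J_sq : ∀ α p v, J α p (J α p v) = -v
  J_mul : ∀ α p v, J α p v = J (α + 1) p (J (α + 2) p v)
  J_anticomm : ∀ α p v, J (α + 1) p (J (α + 2) p v) = -J (α + 2) p (J (α + 1) p v)
  g_J : ∀ α p v w, g.val p v w = sign α * g.val p (J α p v) (J α p w)

variable {E M}

/-- The vector field `X` is smooth. -/
def SmoothField (X : VField E M) : Prop :=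
  ContMDiff 𝓘(ℝ, E) 𝓘(ℝ, E).tangent ∞ (fun p ↦ (⟨p, X p⟩ : TangentBundle 𝓘(ℝ, E) M))

/-- The derivative `X f` of the function `f` along the vector field `X`. -/
def dirDeriv (X : VField E M) (f : M → ℝ) (p : M) : ℝ :=
  mfderiv 𝓘(ℝ, E) 𝓘(ℝ, ℝ) f p (X p)

/-- `∇_X Y`. -/
def nabla (D : Connection E M) (X Y : VField E M) : VField E M := fun p ↦ D Y p (X p)

/-- `(∇_X J) Y = ∇_X (J Y) - J (∇_X Y)` for a tensor field `J` of type `(1,1)`. -/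
def nablaEnd (D : Connection E M) (J : EndField E M) (X Y : VField E M) : VField E M :=
  fun p ↦ nabla D X (fun q ↦ J q (Y q)) p - J p (nabla D X Y p)

/-- The connection preserves the tensor field `J` of type `(1,1)`. -/
def PreservesEnd (D : Connection E M) (J : EndField E M) : Prop :=
  ∀ X Y : VField E M, SmoothField X → SmoothField Y → ∀ p, nablaEnd D J X Y p = 0

/-- The connection preserves the metric: `X g(Y, Z) = g(D_X Y, Z) + g(Y, D_X Z)`. -/
def PreservesMetric (D : Connection E M) (g : PseudoMetric E M) : Prop :=
  ∀ X Y Z : VField E M, SmoothField X → SmoothField Y → SmoothField Z → ∀ p,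
    dirDeriv X (fun q ↦ g.val q (Y q) (Z q)) p
      = g.val p (nabla D X Y p) (Z p) + g.val p (Y p) (nabla D X Z p)

/-- The structural tensor `F(X, Y, Z) = g((∇_X J) Y, Z)`. -/
def structuralTensor (D : Connection E M) (g : PseudoMetric E M)
    (J : EndField E M) (X Y Z : VField E M) (p : M) : ℝ :=
  g.val p (nablaEnd D J X Y p) (Z p)

/-- The class `𝒲₁(J)` of nearly Kähler manifolds: `F(X, Y, Z) = -F(Y, X, Z)`, where `F` is taken
with respect to the connection `D` (to be the Levi-Civita connection). -/
def IsNearlyKahler (D : Connection E M) (g : PseudoMetric E M)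
    (J : EndField E M) : Prop :=
  ∀ X Y Z : VField E M, SmoothField X → SmoothField Y → SmoothField Z → ∀ p,
    structuralTensor D g J X Y Z p = -structuralTensor D g J Y X Z p

/-- The class `𝒲₃(J)` of quasi-Kähler manifolds with Norden metric: the cyclic sum of
`F(X, Y, Z)` vanishes, where `F` is taken with respect to the connection `D` (to be the Levi-Civita
connection). -/
def IsQuasiKahlerNorden (D : Connection E M) (g : PseudoMetric E M)
    (J : EndField E M) : Prop :=
  ∀ X Y Z : VField E M, SmoothField X → SmoothField Y → SmoothField Z → ∀ p,
    structuralTensor D g J X Y Z p + structuralTensor D g J Y Z X p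
      + structuralTensor D g J Z X Y p = 0

/-- The class `𝒲₁₃₃ = 𝒲₁(J₁) ∩ 𝒲₃(J₂) ∩ 𝒲₃(J₃)`; `D` is to be the Levi-Civita connection. -/
def IsW133 (D : Connection E M) (S : AlmostHGStructure E M) : Prop :=
  IsNearlyKahler D S.g (S.J 0) ∧ IsQuasiKahlerNorden D S.g (S.J 1) ∧
    IsQuasiKahlerNorden D S.g (S.J 2)

/-- The curvature `K(X, Y) Z = D_X D_Y Z - D_Y D_X Z - D_[X,Y] Z`. -/
def curvature (D : Connection E M) (X Y Z : VField E M) : VField E M :=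
  fun p ↦ nabla D X (nabla D Y Z) p - nabla D Y (nabla D X Z) p
    - nabla D (VectorField.mlieBracket 𝓘(ℝ, E) X Y) Z p

/-- The connection is flat: its curvature vanishes. -/
def IsFlat (D : Connection E M) : Prop :=
  ∀ X Y Z : VField E M, SmoothField X → SmoothField Y → SmoothField Z → ∀ p,
    curvature D X Y Z p = 0

section Torsion

variable [FiniteDimensional ℝ E] [CompleteSpace E]

/-- `D` is the Levi-Civita connection of `g`: torsion-free and metric. -/
def IsLeviCivita (D : Connection E M) (g : PseudoMetric E M) : Prop :=
  D.torsion = 0 ∧ PreservesMetric D g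

/-- The torsion tensor of type `(0,3)`: `T(X, Y, Z) = g(T(X, Y), Z)`. -/
def torsion3 (D : Connection E M) (g : PseudoMetric E M) (X Y Z : VField E M) (p : M) : ℝ :=
  g.val p (D.torsion p (X p) (Y p)) (Z p)

/-- The torsion is totally skew-symmetric, i.e. a 3-form. -/
def HasSkewTorsion (D : Connection E M) (g : PseudoMetric E M) : Prop :=
  ∀ p u v w, g.val p (D.torsion p u v) w = -g.val p (D.torsion p v u) w ∧
    g.val p (D.torsion p u v) w = -g.val p (D.torsion p u w) v

/-- `D` is a pHKT-connection: it preserves `J₁`, `J₂`, `J₃` and `g`, and its torsion is totally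
skew-symmetric. -/
def IsPHKT (D : Connection E M) (S : AlmostHGStructure E M) : Prop :=
  (∀ α, PreservesEnd D (S.J α)) ∧ PreservesMetric D S.g ∧ HasSkewTorsion D S.g

/-- `(dτ)(X, Y, Z, W)` for a 3-form `τ`, given through its values on vector fields, by the
invariant formula for the exterior derivative. -/
def extDeriv3 (τ : VField E M → VField E M → VField E M → M → ℝ) (X Y Z W : VField E M) (p : M) :
    ℝ :=
  dirDeriv X (τ Y Z W) p - dirDeriv Y (τ X Z W) p
    + dirDeriv Z (τ X Y W) p - dirDeriv W (τ X Y Z) p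
    - τ (VectorField.mlieBracket 𝓘(ℝ, E) X Y) Z W p
    + τ (VectorField.mlieBracket 𝓘(ℝ, E) X Z) Y W p
    - τ (VectorField.mlieBracket 𝓘(ℝ, E) X W) Y Z p
    - τ (VectorField.mlieBracket 𝓘(ℝ, E) Y Z) X W p
    + τ (VectorField.mlieBracket 𝓘(ℝ, E) Y W) X Z p
    - τ (VectorField.mlieBracket 𝓘(ℝ, E) Z W) X Y p

/-- The connection `D` is strong: `dT = 0` for its torsion 3-form `T`. -/
def IsStrong (D : Connection E M) (g : PseudoMetric E M) : Prop :=
  ∀ X Y Z W : VField E M, SmoothField X → SmoothField Y → SmoothField Z → SmoothField W → ∀ p,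
    extDeriv3 (torsion3 D g) X Y Z W p = 0

/-- The torsion `T` of `D` is parallel with respect to the connection `D'`: `(D'_X T)(Y, Z, W) =
X T(Y, Z, W) - T(D'_X Y, Z, W) - T(Y, D'_X Z, W) - T(Y, Z, D'_X W)` vanishes. -/
def HasParallelTorsion (D' D : Connection E M) (g : PseudoMetric E M) : Prop :=
  ∀ X Y Z W : VField E M, SmoothField X → SmoothField Y → SmoothField Z → SmoothField W → ∀ p,
    dirDeriv X (torsion3 D g Y Z W) p - torsion3 D g (nabla D' X Y) Z W p
      - torsion3 D g Y (nabla D' X Z) W p - torsion3 D g Y Z (nabla D' X W) p = 0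

end Torsion

end HGGeometry

end

/-!
Write `T` for the torsion of the pHKT-connection `D` and `K` for its curvature, and let
`σ(x, y, z, w)` be the cyclic sum over `x, y, z` of `g(T(x, y), T(z, w))`, a 4-form. The point is
that `T` is `D`-parallel; granted this, each of the three conditions says that `σ = 0`.

* A metric connection with skew torsion is `D = ∇ + T / 2` (`nabla_eq_add_half_torsion`), so the
  condition that the structure `J₁` is nearly Kähler becomes
  `T(J₁ x, y, z) = T(x, J₁ y, z) = T(x, y, J₁ z)` (`metric_torsion_J`): `T`, hence also `D_x T`, is
  of type `(3,0) + (0,3)`. The curvature `K` commutes with `J₁`. Decomposed by types, the first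
  Bianchi identity `cyc K = cyc D T + σ` (`first_bianchi`) then forces `D T = 0`
  (`covDeriv_torsion_eq_zero`, `covDerivTorsion_eq_zero`).
* With `D T = 0` one finds `dT = 2 σ` (`extDeriv3_torsion3`) and `∇ T = σ / 2`
  (`covDerivTorsion_leviCivita`).
* With `D T = 0` the Bianchi identity reads `cyc K = σ`, so `K = 0` implies `σ = 0`. Conversely, if
  `σ = 0`, then `K` has the symmetries of a Riemannian curvature tensor and commutes with `J₁`, `J₂`
  and `J₃`. For the Norden structures `J₂` and `J₃` this gives `K(J x, y) = J K(x, y)`, which is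
  incompatible with the Hermitian structure `J₁ = J₂ J₃` unless `K = 0` (`curvature_eq_zero`).

All identities are proved for global smooth vector fields at a given point. The tensors therefore
enter the algebraic part as real-valued functions on an arbitrary type, with no linearity assumed.
-/

namespace HGGeometry

/-! ### Algebra of the first Bianchi identity -/

section Algebra

variable {V : Type*}

/-- The symmetry defect of the curvature `K` of a metric connection with skew torsion under exchange
of the two pairs of arguments. Here `A` stands for the covariant derivative of the torsion and `q`
for `g(T(x, y), T(z, w))`. It is the octahedron argument, an alternating sum of the Bianchi identity
over the choices of the last argument, in which the 4-form given by the cyclic sum of `q` drops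
out. -/
theorem curvature_sub_swap_pairs {K A q : V → V → V → V → ℝ}
    (hK₁ : ∀ x y z w, K y x z w = -K x y z w) (hK₂ : ∀ x y z w, K x y w z = -K x y z w)
    (hA₁ : ∀ x y z w, A x z y w = -A x y z w) (hA₂ : ∀ x y z w, A x y w z = -A x y z w)
    (hq₁ : ∀ x y z w, q y x z w = -q x y z w) (hq₂ : ∀ x y z w, q x y z w = q z w x y)
    (bianchi : ∀ x y z w, K x y z w + K y z x w + K z x y w
      = A x y z w + A y z x w + A z x y w + (q x y z w + q y z x w + q z x y w))
    (x y z w : V) :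
    2 * (K x y z w - K z w x y) = A x y z w - A y x z w - A z x y w + A w x y z := by
  have hq₃ : ∀ x y z w, q x y w z = -q x y z w := fun x y z w ↦ by
    rw [hq₂, hq₁, hq₂ z w]
  linarith [bianchi x y z w, bianchi y z w x, bianchi z w x y, bianchi w x y z, hK₂ y z x w,
    hK₁ x z y w, hK₂ x z y w, hK₂ z w x y, hK₂ x y z w, hK₁ y w z x, hK₂ y w z x, hK₂ w x y z,
    hA₂ x z y w, hA₁ x y z w, hA₂ x y z w, hA₂ y z x w, hA₂ y x z w, hA₁ y x w z, hA₂ z x y w,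
    hA₁ z x w y, hA₂ z w x y, hA₂ w x y z, hA₁ w x y z, hA₂ w y x z, hq₃ x y z w, hq₃ y z x w,
    hq₂ z w x y, hq₃ z w x y, hq₁ x z y w, hq₁ z x w y, hq₃ w x y z, hq₁ y w x z, hq₂ y w x z,
    hq₂ x z w y, hq₂ z x w y]

/-- Vanishing of the covariant derivative `A` of the torsion of the characteristic connection of a
nearly Kähler structure `J`, as an algebraic consequence of the first Bianchi identity. Neither
`V` nor the maps carry a linear structure: only the behaviour under permutations of the arguments
and under `J` is used. In terms of the types `(1,0)` and `(0,1)` of complex vectors,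
`A(x; y, z, w)` is nonzero only if `y, z, w` have the same type, and `K(x, y, z, w)` only if
`z` and `w` have different types. The proof first kills the part of `A` where `x` has the same type
as `y, z, w`, then the part where it has the opposite type. -/
theorem covDeriv_torsion_eq_zero {K A q : V → V → V → V → ℝ} {J : V → V}
    (hK₁ : ∀ x y z w, K y x z w = -K x y z w) (hK₂ : ∀ x y z w, K x y w z = -K x y z w)
    (hA₁ : ∀ x y z w, A x z y w = -A x y z w) (hA₂ : ∀ x y z w, A x y w z = -A x y z w)
    (hq₁ : ∀ x y z w, q y x z w = -q x y z w) (hq₂ : ∀ x y z w, q x y z w = q z w x y)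
    (bianchi : ∀ x y z w, K x y z w + K y z x w + K z x y w
      = A x y z w + A y z x w + A z x y w + (q x y z w + q y z x w + q z x y w))
    (hKJ : ∀ x y z w, K x y (J z) (J w) = K x y z w)
    (hKJJ₃ : ∀ x y z w, K x y (J (J z)) w = -K x y z w)
    (hAJ : ∀ x y z w, A x (J y) z w = A x y (J z) w)
    (hAJJ₂ : ∀ x y z w, A x (J (J y)) z w = -A x y z w)
    (hqJ₁ : ∀ x y z w, q (J x) y z w = q x (J y) z w)
    (hqJ₃ : ∀ x y z w, q (J x) y z w = -q x y (J z) w)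
    (hqJJ : ∀ x y z w, q (J (J x)) y z w = -q x y z w)
    (x y z w : V) : A x y z w = 0 := by
  have hq₃ : ∀ x y z w, q x y w z = -q x y z w := fun x y z w ↦ by
    rw [hq₂, hq₁, hq₂ z w]
  -- Normal forms: `J` is moved to the first possible argument, and `J (J _)` is removed.
  have hAJ₃ : ∀ x y z w, A x y z (J w) = A x (J y) z w := fun x y z w ↦ by
    rw [hA₂ x y (J w) z, ← hAJ, hA₂, neg_neg]
  have hAJ₂ : ∀ x y z w, A x y (J z) w = A x (J y) z w := fun x y z w ↦ (hAJ x y z w).symm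
  have hqJ₂ : ∀ x y z w, q x (J y) z w = q (J x) y z w := fun x y z w ↦ (hqJ₁ x y z w).symm
  have hqJ₄ : ∀ x y z w, q x y (J z) w = -q (J x) y z w := fun x y z w ↦ by
    rw [hqJ₃, neg_neg]
  have hqJ₅ : ∀ x y z w, q x y z (J w) = -q (J x) y z w := fun x y z w ↦ by
    rw [hq₃, hqJ₄, hq₃, neg_neg]
  have hKJ₄ : ∀ x y z w, K x y z (J w) = -K x y (J z) w := fun x y z w ↦ by
    rw [← hKJ x y z (J w), hK₂, hKJJ₃, hK₂, neg_neg]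
  have pairs := curvature_sub_swap_pairs hK₁ hK₂ hA₁ hA₂ hq₁ hq₂ bianchi
  -- Up to a factor 2, `B` is the part of `A` for which all four arguments have the same type.
  set B : V → V → V → V → ℝ := fun x y z w ↦ A x y z w - A (J x) (J y) z w with hB
  have hB₁ : ∀ x y z w, B x z y w = -B x y z w := fun x y z w ↦ by
    simp only [hB]; rw [hA₁ x y z w, hA₁ (J x) y (J z) w, ← hAJ]; ring
  have hB₂ : ∀ x y z w, B x y w z = -B x y z w := fun x y z w ↦ by
    simp only [hB]; rw [hA₂ x y z w, hA₂ (J x) (J y) z w]; ring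
  -- Projecting to equal types in `x, y` and in `z, w` removes both curvature terms of `pairs`.
  have hB₃ : ∀ x y z w, B x y z w - B y x z w - B z x y w + B w x y z = 0 := fun x y z w ↦ by
    have h1 := pairs x y z w
    have h2 := pairs (J x) (J y) z w
    have h3 := pairs x y (J z) (J w)
    have h4 := pairs (J x) (J y) (J z) (J w)
    simp only [hKJ, hAJ₂, hAJ₃, hAJJ₂] at h1 h2 h3 h4
    simp only [hB]
    linarith
  -- Together with its symmetries, this makes `B` totally skew.
  have hB₄ : ∀ x y z w, B y x z w = -B x y z w := fun x y z w ↦ by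
    linarith [hB₃ z x y w, hB₃ z y x w, hB₁ z x y w, hB₂ w z x y, hB₁ x y z w, hB₁ y x z w]
  -- Projecting the Bianchi identity to four arguments of the same type removes `K` and `q`; the
  -- cyclic sum of the totally skew `B` is `3 * B`.
  have hB₀ : ∀ x y z w, B x y z w = 0 := fun x y z w ↦ by
    have h1 := bianchi x y z w
    have h2 := bianchi (J x) (J y) z w
    have h3 := bianchi (J x) y (J z) w
    have h4 := bianchi (J x) y z (J w)
    have h5 := bianchi x (J y) (J z) w
    have h6 := bianchi x (J y) z (J w)
    have h7 := bianchi x y (J z) (J w)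
    have h8 := bianchi (J x) (J y) (J z) (J w)
    simp only [hKJ, hKJ₄, hAJ₂, hAJ₃, hAJJ₂, hqJ₂, hqJ₄, hqJ₅, hqJJ]
      at h1 h2 h3 h4 h5 h6 h7 h8
    have e1 : B y z x w = B x y z w := by rw [hB₁, hB₄]; ring
    have e2 : B z x y w = B x y z w := by rw [hB₄, hB₁]; ring
    simp only [hB] at e1 e2 ⊢
    linarith
  have hA₀ : ∀ x y z w, A (J x) (J y) z w = A x y z w := fun x y z w ↦
    (sub_eq_zero.1 (hB₀ x y z w)).symm
  have hA₀' : ∀ x y z w, A (J x) y z w = -A x (J y) z w := fun x y z w ↦ by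
    rw [← hA₀ x (J y), hAJJ₂, neg_neg]
  -- The left side is, up to a factor, the part of `K z w y x` where `y, z, w` have the same type
  -- and `x` the opposite one.
  have N : ∀ y z w, K z w y x - K (J z) (J w) y x - K (J z) w (J y) x - K z (J w) (J y) x
      = 2 * A x y z w := fun y z w ↦ by
    have h1 := pairs y x z w
    have h2 := pairs y x (J z) (J w)
    have h3 := pairs (J y) x (J z) w
    have h4 := pairs (J y) x z (J w)
    simp only [hKJ, hKJ₄, hAJ₂, hAJ₃, hAJJ₂, hA₀'] at h1 h2 h3 h4
    linarith
  -- The same projection of the Bianchi identity removes `A` and `q` from its right side, and its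
  -- left side is a sum of three terms that are all multiples of `A x y z w`.
  have h1 := bianchi y z w x
  have h2 := bianchi (J y) (J z) w x
  have h3 := bianchi (J y) z (J w) x
  have h4 := bianchi y (J z) (J w) x
  have h5 := bianchi (J y) z w (J x)
  have h6 := bianchi y (J z) w (J x)
  have h7 := bianchi y z (J w) (J x)
  have h8 := bianchi (J y) (J z) (J w) (J x)
  simp only [hKJ, hKJ₄, hAJ₂, hAJ₃, hAJJ₂, hqJ₂, hqJ₄, hqJ₅, hqJJ, hA₀']
    at h1 h2 h3 h4 h5 h6 h7 h8
  have n1 := N y z w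
  have n2 := N z w y
  have n3 := N w y z
  have e1 : A x z w y = A x y z w := by rw [hA₂, hA₁]; ring
  have e2 : A x w y z = A x y z w := by rw [hA₁, hA₂]; ring
  linarith

/-- A curvature-like tensor that commutes with a hypercomplex structure, where `J₁` is Hermitian
and `J₂`, `J₃` are Norden, vanishes: the Norden structures satisfy `K(J x, y) = J K(x, y)`,
hence `K(J₁ x, y) = -J₁ K(x, y)` because `J₁` is the product `J₂ J₃ = -J₃ J₂`, and this contradicts
`K(J₁ x, J₁ y) = K(x, y)`. -/
theorem curvature_eq_zero {K : V → V → V → V → ℝ} {J₁ J₂ J₃ : V → V}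
    (hK₁ : ∀ x y z w, K y x z w = -K x y z w) (hK₂ : ∀ x y z w, K x y w z = -K x y z w)
    (bianchi : ∀ x y z w, K x y z w + K y z x w + K z x y w = 0)
    (hJ₁ : ∀ x, J₁ x = J₂ (J₃ x))
    (hJ₃₂ : ∀ x y z w, K x y (J₃ (J₂ z)) w = -K x y (J₁ z) w)
    (hJJ : ∀ x y z w, K x y (J₁ (J₁ z)) w = -K x y z w)
    (h₁ : ∀ x y z w, K x y (J₁ z) (J₁ w) = K x y z w)
    (h₂ : ∀ x y z w, K x y (J₂ z) w = K x y z (J₂ w))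
    (h₃ : ∀ x y z w, K x y (J₃ z) w = K x y z (J₃ w))
    (x y z w : V) : K x y z w = 0 := by
  have pair : ∀ x y z w, K x y z w = K z w x y := fun x y z w ↦ by
    have := curvature_sub_swap_pairs (A := fun _ _ _ _ ↦ 0) (q := fun _ _ _ _ ↦ 0) hK₁ hK₂
      (by simp) (by simp) (by simp) (by simp) (by simpa using bianchi) x y z w
    linarith
  -- The Bianchi identities with `J` on one of the four arguments add up to `K(J x, y) = J K(x, y)`.
  have move : ∀ J : V → V, (∀ x y z w, K x y (J z) w = K x y z (J w)) →
      ∀ x y z w, K (J x) y z w = K x y (J z) w := fun J hJ x y z w ↦ by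
    have hJ' : ∀ x y z w, K x (J y) z w = K (J x) y z w := fun x y z w ↦ by
      rw [pair, ← hJ, pair]
    have b1 := bianchi (J x) y z w
    have b2 := bianchi x (J y) z w
    have b3 := bianchi x y (J z) w
    have b4 := bianchi x y z (J w)
    simp only [← hJ, hJ'] at b1 b2 b3 b4
    linarith
  have m₁ : ∀ x y z w, K (J₁ x) y z w = -K x y (J₁ z) w := fun x y z w ↦ by
    rw [hJ₁ x, move J₂ h₂, move J₃ h₃, hJ₃₂]
  have m₁' : ∀ x y z w, K x (J₁ y) z w = -K x y (J₁ z) w := fun x y z w ↦ by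
    rw [hK₁, m₁, hK₁, neg_neg]
  have := calc K x y z w = K (J₁ x) (J₁ y) z w := by rw [pair x, ← h₁, pair]
    _ = -K x y z w := by rw [m₁, m₁', neg_neg, hJJ]
  linarith

end Algebra

variable {E : Type*} [NormedAddCommGroup E] [NormedSpace ℝ E]
  {M : Type*} [TopologicalSpace M] [ChartedSpace E M]

/-! ### Smooth vector fields and directional derivatives -/

section Fields

variable {X Y Z W : VField E M}

theorem dirDeriv_add {f h : M → ℝ} {p : M} (hf : MDifferentiableAt 𝓘(ℝ, E) 𝓘(ℝ, ℝ) f p)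
    (hh : MDifferentiableAt 𝓘(ℝ, E) 𝓘(ℝ, ℝ) h p) :
    dirDeriv X (fun q ↦ f q + h q) p = dirDeriv X f p + dirDeriv X h p :=
  congr($(mvfderiv_add hf hh) (X p))

theorem dirDeriv_neg (f : M → ℝ) (p : M) :
    dirDeriv X (fun q ↦ -f q) p = -dirDeriv X f p :=
  congr($(mvfderiv_neg (I := 𝓘(ℝ, E)) (g := f) (x := p)) (X p))

theorem dirDeriv_eq_zero {f : M → ℝ} {p : M} (h : X p = 0) : dirDeriv X f p = 0 :=
  (congrArg (mfderiv 𝓘(ℝ, E) 𝓘(ℝ, ℝ) f p) h).trans (map_zero _)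

variable [IsManifold 𝓘(ℝ, E) ∞ M]

theorem SmoothField.mdifferentiableAt (hX : SmoothField X) (p : M) :
    MDifferentiableAt 𝓘(ℝ, E) 𝓘(ℝ, E).tangent
      (fun p ↦ (⟨p, X p⟩ : TangentBundle 𝓘(ℝ, E) M)) p :=
  (hX p).mdifferentiableAt (by simp)

theorem SmoothField.nabla (D : Connection E M) [hD : D.ContMDiffCovariantDerivative ∞]
    (hX : SmoothField X) (hY : SmoothField Y) : SmoothField (nabla D X Y) := by
  have h := hD.contMDiff.contMDiff (σ := Y) (hY.contMDiffOn)
  rw [contMDiffOn_univ] at h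
  exact ContMDiff.clm_bundle_apply h hX

theorem SmoothField.J (S : AlmostHGStructure E M) (α : Fin 3) (hX : SmoothField X) :
    SmoothField (fun p ↦ S.J α p (X p)) :=
  ContMDiff.clm_bundle_apply (S.contMDiff_J α) hX

theorem SmoothField.mlieBracket [CompleteSpace E] (hX : SmoothField X) (hY : SmoothField Y) :
    SmoothField (VectorField.mlieBracket 𝓘(ℝ, E) X Y) := by
  have : IsManifold 𝓘(ℝ, E) (minSmoothness ℝ 2) M := by
    simp only [minSmoothness_of_isRCLikeNormedField]
    infer_instance
  have : IsManifold 𝓘(ℝ, E) ((⊤ : ℕ∞) + 1) M := by simpa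
  exact fun p ↦ ContMDiffAt.mlieBracket_vectorField (n := ⊤) (m := ⊤) (hX p) (hY p) (by simp)

theorem contMDiff_metric (g : PseudoMetric E M) (hX : SmoothField X) (hY : SmoothField Y) :
    ContMDiff 𝓘(ℝ, E) 𝓘(ℝ, ℝ) ∞ (fun p ↦ g.val p (X p) (Y p)) := by
  have : ContMDiff 𝓘(ℝ, E) (𝓘(ℝ, E).prod 𝓘(ℝ)) ∞
      (fun m ↦ Bundle.TotalSpace.mk' ℝ (E := Bundle.Trivial M ℝ) m (g.val m (X m) (Y m))) :=
    ContMDiff.clm_bundle_apply₂ (F₁ := E) (F₂ := E) g.contMDiff hX hY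
  exact fun p ↦ (Bundle.contMDiffAt_totalSpace.1 (this p)).2

/-- Every tangent vector is the value of a global smooth vector field, by a bump function. -/
theorem exists_smoothField [FiniteDimensional ℝ E] [T2Space M] (p : M)
    (v : TangentSpace 𝓘(ℝ, E) p) : ∃ X : VField E M, SmoothField X ∧ X p = v := by
  obtain ⟨s, hs, hX⟩ := FiberBundle.exists_contMDiffOn_extend (k := ∞) 𝓘(ℝ, E) E v
  obtain ⟨u, hus, hu, hpu⟩ := mem_nhds_iff.1 hs
  obtain ⟨f, hf, -⟩ := (SmoothBumpFunction.nhds_basis_support (I := 𝓘(ℝ, E))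
    (hu.mem_nhds hpu)).mem_iff.1 (hu.mem_nhds hpu)
  refine ⟨(f : M → ℝ) • FiberBundle.extend E v, ?_, by simp⟩
  exact ContMDiffOn.smul_section_of_tsupport f.contMDiff.contMDiffOn hu hf (hX.mono hus)

/-- `[X, Y] f = X (Y f) - Y (X f)`. This follows from the Leibniz rule
`[X, f Z] = (X f) Z + f [X, Z]` by comparing the Jacobi identities for `X, Y, f Z` and for `X, Y, Z`, where `Z` does not vanish at
the given point. -/
theorem dirDeriv_mlieBracket [FiniteDimensional ℝ E] [CompleteSpace E] [T2Space M]
    (hX : SmoothField X) (hY : SmoothField Y) {f : M → ℝ}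
    (hf : ContMDiff 𝓘(ℝ, E) 𝓘(ℝ, ℝ) ∞ f)
    (hXf : ContMDiff 𝓘(ℝ, E) 𝓘(ℝ, ℝ) ∞ (dirDeriv X f))
    (hYf : ContMDiff 𝓘(ℝ, E) 𝓘(ℝ, ℝ) ∞ (dirDeriv Y f)) (p : M) :
    dirDeriv (VectorField.mlieBracket 𝓘(ℝ, E) X Y) f p
      = dirDeriv X (dirDeriv Y f) p - dirDeriv Y (dirDeriv X f) p := by
  have : IsManifold 𝓘(ℝ, E) (minSmoothness ℝ 2) M := by
    simp only [minSmoothness_of_isRCLikeNormedField]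
    infer_instance
  have : IsManifold 𝓘(ℝ, E) (minSmoothness ℝ 3) M := by
    simp only [minSmoothness_of_isRCLikeNormedField]
    infer_instance
  by_cases h : ∀ v : TangentSpace 𝓘(ℝ, E) p, v = 0
  · rw [dirDeriv_eq_zero (h _), dirDeriv_eq_zero (h _), dirDeriv_eq_zero (h _), sub_zero]
  push Not at h
  obtain ⟨v, hv⟩ := h
  obtain ⟨Z, hZ, rfl⟩ := exists_smoothField p v
  have leib : ∀ {X : VField E M} {f : M → ℝ}, ContMDiff 𝓘(ℝ, E) 𝓘(ℝ, ℝ) ∞ f →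
      ∀ {Z : VField E M}, SmoothField Z → VectorField.mlieBracket 𝓘(ℝ, E) X (f • Z)
        = dirDeriv X f • Z + f • VectorField.mlieBracket 𝓘(ℝ, E) X Z := fun hf _ hZ ↦
    funext fun q ↦ VectorField.mlieBracket_smul_right
      (hf.mdifferentiable (by simp) q) (hZ.mdifferentiableAt q)
  have smul : ∀ {f : M → ℝ}, ContMDiff 𝓘(ℝ, E) 𝓘(ℝ, ℝ) ∞ f →
      ∀ {Z : VField E M}, SmoothField Z → SmoothField (f • Z) := fun hf _ hZ ↦
    ContMDiff.smul_section hf hZ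
  have two : minSmoothness ℝ 2 ≤ ∞ := by
    simp only [minSmoothness_of_isRCLikeNormedField]; exact ENat.LEInfty.out
  have jacobi : ∀ {Z : VField E M}, SmoothField Z → _ := fun {Z} hZ ↦
    VectorField.leibniz_identity_mlieBracket_apply (x := p) (W := Z) ((hX p).of_le two)
      ((hY p).of_le two) ((hZ p).of_le two)
  have J1 := jacobi (smul hf hZ)
  have J2 := jacobi hZ
  rw [leib hf hZ, leib hf hZ, leib hf hZ,
    VectorField.mlieBracket_add_right ((smul hYf hZ).mdifferentiableAt p)
      ((smul hf (hY.mlieBracket hZ)).mdifferentiableAt p),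
    VectorField.mlieBracket_add_right ((smul hXf hZ).mdifferentiableAt p)
      ((smul hf (hX.mlieBracket hZ)).mdifferentiableAt p),
    leib hYf hZ, leib hXf hZ, leib hf (hY.mlieBracket hZ), leib hf (hX.mlieBracket hZ)] at J1
  simp only [Pi.add_apply, Pi.smul_apply', J2] at J1
  have key : (dirDeriv (VectorField.mlieBracket 𝓘(ℝ, E) X Y) f p
      - (dirDeriv X (dirDeriv Y f) p - dirDeriv Y (dirDeriv X f) p)) • Z p = 0 := by
    rw [← neg_zero, ← sub_eq_zero.2 J1]
    module
  exact sub_eq_zero.1 ((smul_eq_zero.1 key).resolve_right hv)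

end Fields

variable [IsManifold 𝓘(ℝ, E) ∞ M]

/-! ### The metric and the almost complex structures -/

section Pointwise

theorem AlmostHGStructure.g_J_left (S : AlmostHGStructure E M) (α : Fin 3) (p : M)
    (v w : TangentSpace 𝓘(ℝ, E) p) :
    S.g.val p (S.J α p v) w = -sign α * S.g.val p v (S.J α p w) := by
  rw [S.g_J α p (S.J α p v), S.J_sq, map_neg, neg_apply]
  ring

theorem PseudoMetric.ext_left (g : PseudoMetric E M) {p : M} {v w : TangentSpace 𝓘(ℝ, E) p}
    (h : ∀ u, g.val p v u = g.val p w u) : v = w :=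
  sub_eq_zero.1 <| g.nondegenerate p _ fun u ↦ by
    rw [map_sub]; exact sub_eq_zero.2 (h u)

end Pointwise

/-! ### Curvature of a connection -/

section Connection

variable {D : Connection E M} {X Y Z W : VField E M}

theorem nabla_add (hY : SmoothField Y) (hZ : SmoothField Z) (p : M) :
    nabla D X (Y + Z) p = nabla D X Y p + nabla D X Z p :=
  congr($(D.isCovariantDerivativeOnUniv.add (hY.mdifferentiableAt p)
    (hZ.mdifferentiableAt p)) (X p))

theorem curvature_swap (p : M) : curvature D Y X Z p = -curvature D X Y Z p := by
  have h : nabla D (VectorField.mlieBracket 𝓘(ℝ, E) Y X) Z p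
      = -nabla D (VectorField.mlieBracket 𝓘(ℝ, E) X Y) Z p := by
    simp only [nabla]
    rw [VectorField.mlieBracket_swap_apply, map_neg]
  simp only [curvature, h]
  abel

theorem nabla_J {S : AlmostHGStructure E M} {α : Fin 3} (hJ : PreservesEnd D (S.J α))
    {X Y : VField E M} (hX : SmoothField X) (hY : SmoothField Y) :
    nabla D X (fun q ↦ S.J α q (Y q)) = fun q ↦ S.J α q (nabla D X Y q) :=
  funext fun q ↦ sub_eq_zero.1 (hJ _ _ hX hY q)

theorem curvature_J [D.ContMDiffCovariantDerivative ∞] {S : AlmostHGStructure E M} {α : Fin 3}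
    (hJ : PreservesEnd D (S.J α)) [CompleteSpace E]
    (hX : SmoothField X) (hY : SmoothField Y) (hZ : SmoothField Z) (p : M) :
    curvature D X Y (fun q ↦ S.J α q (Z q)) p = S.J α p (curvature D X Y Z p) := by
  simp only [curvature, nabla_J hJ hX hZ, nabla_J hJ hY hZ, nabla_J hJ hX (hY.nabla D hZ),
    nabla_J hJ hY (hX.nabla D hZ), nabla_J hJ (hX.mlieBracket hY) hZ, map_sub]

/-- The curvature of a metric connection is skew-adjoint: evaluate `[X, Y]` on `g(Z, W)`. -/
theorem metric_curvature_skew [FiniteDimensional ℝ E] [CompleteSpace E] [T2Space M]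
    [D.ContMDiffCovariantDerivative ∞] {g : PseudoMetric E M} (hg : PreservesMetric D g)
    (hX : SmoothField X) (hY : SmoothField Y) (hZ : SmoothField Z) (hW : SmoothField W) (p : M) :
    g.val p (curvature D X Y W p) (Z p) = -g.val p (curvature D X Y Z p) (W p) := by
  have diff : ∀ {X : VField E M}, SmoothField X → dirDeriv X (fun q ↦ g.val q (Z q) (W q))
      = fun q ↦ g.val q (nabla D X Z q) (W q) + g.val q (Z q) (nabla D X W q) := fun hX ↦
    funext (hg _ _ _ hX hZ hW)
  have sm : ∀ {X : VField E M}, SmoothField X → ContMDiff 𝓘(ℝ, E) 𝓘(ℝ, ℝ) ∞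
      (dirDeriv X (fun q ↦ g.val q (Z q) (W q))) := fun hX ↦ by
    rw [diff hX]
    exact (contMDiff_metric g (hX.nabla D hZ) hW).add (contMDiff_metric g hZ (hX.nabla D hW))
  have second : ∀ {X Y : VField E M}, SmoothField X → SmoothField Y →
      dirDeriv X (dirDeriv Y (fun q ↦ g.val q (Z q) (W q))) p
        = g.val p (nabla D X (nabla D Y Z) p) (W p) + g.val p (nabla D Y Z p) (nabla D X W p)
          + (g.val p (nabla D X Z p) (nabla D Y W p)
            + g.val p (Z p) (nabla D X (nabla D Y W) p)) := fun hX hY ↦ by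
    rw [diff hY, dirDeriv_add
      ((contMDiff_metric g (hY.nabla D hZ) hW).mdifferentiable (by simp) p)
      ((contMDiff_metric g hZ (hY.nabla D hW)).mdifferentiable (by simp) p),
      hg _ _ _ hX (hY.nabla D hZ) hW, hg _ _ _ hX hZ (hY.nabla D hW)]
  have h := dirDeriv_mlieBracket hX hY (contMDiff_metric g hZ hW) (sm hX) (sm hY) p
  rw [second hX hY, second hY hX, hg _ _ _ (hX.mlieBracket hY) hZ hW] at h
  have e : ∀ v : TangentSpace 𝓘(ℝ, E) p, g.val p v (Z p) = g.val p (Z p) v := fun v ↦ g.symm p _ _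
  simp only [curvature, map_sub, sub_apply, e]
  linarith

end Connection

/-! ### Connections with skew torsion -/

section Torsion

variable [FiniteDimensional ℝ E] [CompleteSpace E] {D : Connection E M} {X Y Z W : VField E M}

theorem torsion_eq (hX : SmoothField X) (hY : SmoothField Y) (p : M) :
    D.torsion p (X p) (Y p)
      = nabla D X Y p - nabla D Y X p - VectorField.mlieBracket 𝓘(ℝ, E) X Y p :=
  D.torsion_apply (hX.mdifferentiableAt p) (hY.mdifferentiableAt p)

theorem SmoothField.torsion (D : Connection E M) [D.ContMDiffCovariantDerivative ∞]
    (hX : SmoothField X) (hY : SmoothField Y) :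
    SmoothField (fun p ↦ D.torsion p (X p) (Y p)) := by
  have h : (fun p ↦ D.torsion p (X p) (Y p))
      = HGGeometry.nabla D X Y - HGGeometry.nabla D Y X
        - VectorField.mlieBracket 𝓘(ℝ, E) X Y :=
    funext (torsion_eq hX hY)
  rw [h]
  exact ((hX.nabla D hY).sub_section (hY.nabla D hX)).sub_section (hX.mlieBracket hY)

/-- The covariant derivative `(D'_X T)(Y, Z, W)` of the torsion 3-form `T` of `D`, along a possibly
different connection `D'`. -/
noncomputable def covDerivTorsion (D' D : Connection E M) (g : PseudoMetric E M)
    (X Y Z W : VField E M) (p : M) : ℝ :=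
  dirDeriv X (torsion3 D g Y Z W) p - torsion3 D g (nabla D' X Y) Z W p
    - torsion3 D g Y (nabla D' X Z) W p - torsion3 D g Y Z (nabla D' X W) p

/-- The function `g(T(X, Y), T(Z, W))`, where `T` is the torsion of `D`. Its cyclic sum over
`X, Y, Z` is a 4-form if `T` is totally skew-symmetric. -/
noncomputable def torsionSq (D : Connection E M) (g : PseudoMetric E M)
    (X Y Z W : VField E M) (p : M) : ℝ :=
  g.val p (D.torsion p (X p) (Y p)) (D.torsion p (Z p) (W p))

/-- The first Bianchi identity for a metric connection with skew torsion, read as a form by means of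
`g`. -/
theorem first_bianchi [D.ContMDiffCovariantDerivative ∞] {g : PseudoMetric E M}
    (hg : PreservesMetric D g) (hT : HasSkewTorsion D g)
    (hX : SmoothField X) (hY : SmoothField Y) (hZ : SmoothField Z) (hW : SmoothField W) (p : M) :
    g.val p (curvature D X Y Z p) (W p) + g.val p (curvature D Y Z X p) (W p)
        + g.val p (curvature D Z X Y p) (W p)
      = covDerivTorsion D D g X Y Z W p + covDerivTorsion D D g Y Z X W p
        + covDerivTorsion D D g Z X Y W p
        + (torsionSq D g X Y Z W p + torsionSq D g Y Z X W p + torsionSq D g Z X Y W p) := by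
  have : IsManifold 𝓘(ℝ, E) (minSmoothness ℝ 3) M := by
    simp only [minSmoothness_of_isRCLikeNormedField]
    infer_instance
  have two : minSmoothness ℝ 2 ≤ ∞ := by
    simp only [minSmoothness_of_isRCLikeNormedField]; exact ENat.LEInfty.out
  -- `D_X` of the identity `D_Y Z = D_Z Y + T(Y, Z) + [Y, Z]`.
  have step : ∀ {X Y Z : VField E M}, SmoothField X → SmoothField Y → SmoothField Z →
      nabla D X (nabla D Y Z) p = nabla D X (nabla D Z Y) p
        + nabla D X (fun q ↦ D.torsion q (Y q) (Z q)) p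
        + nabla D X (VectorField.mlieBracket 𝓘(ℝ, E) Y Z) p := fun {X Y Z} hX hY hZ ↦ by
    rw [← nabla_add (hZ.nabla D hY) (hY.torsion D hZ),
      ← nabla_add ((hZ.nabla D hY).add_section (hY.torsion D hZ)) (hY.mlieBracket hZ)]
    congr 1
    funext q
    simp only [Pi.add_apply, torsion_eq hY hZ]
    abel
  -- The torsion of `X` and `[Y, Z]`, with the inner bracket replaced by covariant derivatives.
  have step₂ : ∀ {X Y Z : VField E M}, SmoothField X → SmoothField Y → SmoothField Z →
      nabla D X (VectorField.mlieBracket 𝓘(ℝ, E) Y Z) p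
        - nabla D (VectorField.mlieBracket 𝓘(ℝ, E) Y Z) X p
      = VectorField.mlieBracket 𝓘(ℝ, E) X (VectorField.mlieBracket 𝓘(ℝ, E) Y Z) p
        + D.torsion p (X p) (nabla D Y Z p) - D.torsion p (X p) (nabla D Z Y p)
        - D.torsion p (X p) (D.torsion p (Y p) (Z p)) := fun {X Y Z} hX hY hZ ↦ by
    have h := torsion_eq (D := D) hX (hY.mlieBracket hZ) p
    rw [torsion_eq (D := D) hY hZ p, map_sub, map_sub, h]
    abel
  have jacobi : VectorField.mlieBracket 𝓘(ℝ, E) X (VectorField.mlieBracket 𝓘(ℝ, E) Y Z) p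
      + VectorField.mlieBracket 𝓘(ℝ, E) Y (VectorField.mlieBracket 𝓘(ℝ, E) Z X) p
      + VectorField.mlieBracket 𝓘(ℝ, E) Z (VectorField.mlieBracket 𝓘(ℝ, E) X Y) p = 0 := by
    rw [VectorField.leibniz_identity_mlieBracket_apply ((hX p).of_le two)
      ((hY p).of_le two) ((hZ p).of_le two), VectorField.mlieBracket_swap_apply (W := Z),
      VectorField.mlieBracket_swap (V := X) (W := Z), ← neg_one_smul ℝ
        (VectorField.mlieBracket 𝓘(ℝ, E) Z X), VectorField.mlieBracket_const_smul_right
        ((hZ.mlieBracket hX).mdifferentiableAt p)]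
    module
  have vec : curvature D X Y Z p + curvature D Y Z X p + curvature D Z X Y p
      = (nabla D X (fun q ↦ D.torsion q (Y q) (Z q)) p + D.torsion p (X p) (nabla D Y Z p)
          - D.torsion p (X p) (nabla D Z Y p) - D.torsion p (X p) (D.torsion p (Y p) (Z p)))
        + (nabla D Y (fun q ↦ D.torsion q (Z q) (X q)) p + D.torsion p (Y p) (nabla D Z X p)
          - D.torsion p (Y p) (nabla D X Z p) - D.torsion p (Y p) (D.torsion p (Z p) (X p)))
        + (nabla D Z (fun q ↦ D.torsion q (X q) (Y q)) p + D.torsion p (Z p) (nabla D X Y p)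
          - D.torsion p (Z p) (nabla D Y X p) - D.torsion p (Z p) (D.torsion p (X p) (Y p))) := by
    have h1 := step₂ hX hY hZ
    have h2 := step₂ hY hZ hX
    have h3 := step₂ hZ hX hY
    simp only [curvature]
    rw [step hX hY hZ, step hY hZ hX, step hZ hX hY]
    rw [← sub_eq_zero] at h1 h2 h3 ⊢
    have sum := congr($h1 + $h2 + $h3 + $jacobi)
    rw [add_zero, add_zero, add_zero] at sum
    refine Eq.trans ?_ sum
    abel
  have der : ∀ {X Y Z : VField E M}, SmoothField X → SmoothField Y → SmoothField Z →
      g.val p (nabla D X (fun q ↦ D.torsion q (Y q) (Z q)) p) (W p)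
        = covDerivTorsion D D g X Y Z W p + g.val p (D.torsion p (nabla D X Y p) (Z p)) (W p)
          + g.val p (D.torsion p (Y p) (nabla D X Z p)) (W p) := fun {X Y Z} hX hY hZ ↦ by
    have h := hg _ _ _ hX (hY.torsion D hZ) hW p
    simp only [covDerivTorsion]
    change dirDeriv X (torsion3 D g Y Z W) p = _ at h
    rw [h]
    simp only [torsion3]
    ring
  have sq : ∀ X Y Z : VField E M,
      g.val p (D.torsion p (X p) (D.torsion p (Y p) (Z p))) (W p) = -torsionSq D g Y Z X W p :=
    fun X Y Z ↦ by rw [(hT p _ _ _).2, torsionSq, g.symm]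
  have h := congr(g.val p $vec (W p))
  simp only [map_add, map_sub, add_apply, sub_apply, der hX hY hZ, der hY hZ hX, der hZ hX hY,
    sq] at h
  rw [h, (hT p (nabla D X Y p) (Z p) _).1, (hT p (nabla D Y Z p) (X p) _).1,
    (hT p (nabla D Z X p) (Y p) _).1]
  ring

theorem torsionSq_swap {g : PseudoMetric E M} (p : M) :
    torsionSq D g Y X Z W p = -torsionSq D g X Y Z W p := by
  rw [torsionSq, D.torsion_antisymm, map_neg, neg_apply, torsionSq]

theorem torsionSq_pair {g : PseudoMetric E M} (p : M) :
    torsionSq D g X Y Z W p = torsionSq D g Z W X Y p := g.symm _ _ _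

theorem HasSkewTorsion.torsion3_swap₁ {g : PseudoMetric E M} (hT : HasSkewTorsion D g) :
    torsion3 D g Y X Z = fun p ↦ -torsion3 D g X Y Z p :=
  funext fun p ↦ (hT p _ _ _).1

theorem HasSkewTorsion.torsion3_swap₂ {g : PseudoMetric E M} (hT : HasSkewTorsion D g) :
    torsion3 D g X Z Y = fun p ↦ -torsion3 D g X Y Z p :=
  funext fun p ↦ (hT p _ _ _).2

theorem covDerivTorsion_swap₁ {g : PseudoMetric E M} (hT : HasSkewTorsion D g) (p : M) :
    covDerivTorsion D D g X Z Y W p = -covDerivTorsion D D g X Y Z W p := by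
  have h := dirDeriv_neg (X := X) (torsion3 D g Y Z W) p
  simp only [covDerivTorsion]
  rw [hT.torsion3_swap₁ (X := Y), h, hT.torsion3_swap₁ (Y := nabla D X Z),
    hT.torsion3_swap₁ (X := nabla D X Y), hT.torsion3_swap₁ (X := Y) (Y := Z)]
  ring

theorem covDerivTorsion_swap₂ {g : PseudoMetric E M} (hT : HasSkewTorsion D g) (p : M) :
    covDerivTorsion D D g X Y W Z p = -covDerivTorsion D D g X Y Z W p := by
  have h := dirDeriv_neg (X := X) (torsion3 D g Y Z W) p
  simp only [covDerivTorsion]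
  rw [hT.torsion3_swap₂ (Y := Z), h, hT.torsion3_swap₂ (X := nabla D X Y) (Y := Z),
    hT.torsion3_swap₂ (Z := nabla D X W), hT.torsion3_swap₂ (Y := nabla D X Z)]
  ring

/-- The exterior derivative of the torsion 3-form through the covariant derivative of `D`: the
torsion terms that come from the Lie brackets add up to twice the 4-form. -/
theorem extDeriv3_torsion3 {g : PseudoMetric E M} (hT : HasSkewTorsion D g)
    (hX : SmoothField X) (hY : SmoothField Y) (hZ : SmoothField Z) (hW : SmoothField W) (p : M) :
    extDeriv3 (torsion3 D g) X Y Z W p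
      = covDerivTorsion D D g X Y Z W p - covDerivTorsion D D g Y X Z W p
        + covDerivTorsion D D g Z X Y W p - covDerivTorsion D D g W X Y Z p
        + 2 * (torsionSq D g X Y Z W p + torsionSq D g Y Z X W p + torsionSq D g Z X Y W p) := by
  have br : ∀ {X Y : VField E M}, SmoothField X → SmoothField Y → ∀ Z W : VField E M,
      torsion3 D g (VectorField.mlieBracket 𝓘(ℝ, E) X Y) Z W p
        = torsion3 D g (nabla D X Y) Z W p - torsion3 D g (nabla D Y X) Z W p
          - torsionSq D g X Y Z W p := fun {X Y} hX hY Z W ↦ by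
    have h := torsion_eq (D := D) hX hY p
    have h' : torsionSq D g X Y Z W p
        = g.val p (D.torsion p (D.torsion p (X p) (Y p)) (Z p)) (W p) := by
      rw [torsionSq, g.symm, (hT p _ (Z p) _).1, (hT p (Z p) _ _).2]
    rw [h', h]
    simp only [torsion3, map_sub, sub_apply]
    ring
  have sw := fun X Y Z : VField E M ↦ congr_fun (hT.torsion3_swap₁ (X := X) (Y := Y) (Z := Z)) p
  have sw' := fun X Y Z : VField E M ↦ congr_fun (hT.torsion3_swap₂ (X := X) (Y := Y) (Z := Z)) p
  simp only [extDeriv3, covDerivTorsion, br hX hY, br hX hZ, br hX hW, br hY hZ, br hY hW,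
    br hZ hW]
  linarith [sw (nabla D X Z) Y W, sw' Y (nabla D X W) Z, sw (nabla D X W) Y Z,
    sw (nabla D Y Z) X W, sw (nabla D Z Y) X W, sw' X (nabla D Y W) Z, sw (nabla D Y W) X Z,
    sw (nabla D W Y) X Z, sw' X (nabla D Z W) Y, sw (nabla D Z W) X Y,
    sw' X (nabla D W Z) Y, sw (nabla D W Z) X Y,
    torsionSq_swap (D := D) (g := g) (X := X) (Y := Z) (Z := Y) (W := W) p,
    torsionSq_pair (D := D) (g := g) (X := X) (Y := W) (Z := Y) (W := Z) p,
    torsionSq_pair (D := D) (g := g) (X := Y) (Y := W) (Z := X) (W := Z) p,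
    torsionSq_pair (D := D) (g := g) (X := Z) (Y := W) (Z := X) (W := Y) p]

/-- `D = ∇ + T / 2` for a metric connection `D` with skew torsion `T`, where `∇` is the Levi-Civita
connection. The difference of two metric connections is skew in its last two arguments, and it is
recovered from its skew part in the first two as in the Koszul formula. -/
theorem nabla_eq_add_half_torsion [T2Space M] {nab : Connection E M} {g : PseudoMetric E M}
    (hLC : IsLeviCivita nab g) (hg : PreservesMetric D g) (hT : HasSkewTorsion D g)
    (hX : SmoothField X) (hY : SmoothField Y) (p : M) :
    nabla D X Y p = nabla nab X Y p + (2⁻¹ : ℝ) • D.torsion p (X p) (Y p) := by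
  refine g.ext_left fun u ↦ ?_
  obtain ⟨Z, hZ, rfl⟩ := exists_smoothField p u
  have met : ∀ {X Y Z : VField E M}, SmoothField X → SmoothField Y → SmoothField Z →
      g.val p (nabla D X Y p) (Z p) + g.val p (Y p) (nabla D X Z p)
        = g.val p (nabla nab X Y p) (Z p) + g.val p (Y p) (nabla nab X Z p) := fun hX hY hZ ↦ by
    rw [← hg _ _ _ hX hY hZ, hLC.2 _ _ _ hX hY hZ]
  have tor : ∀ {X Y : VField E M}, SmoothField X → SmoothField Y → ∀ Z : VField E M,
      g.val p (D.torsion p (X p) (Y p)) (Z p) = g.val p (nabla D X Y p) (Z p)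
        - g.val p (nabla D Y X p) (Z p) - (g.val p (nabla nab X Y p) (Z p)
        - g.val p (nabla nab Y X p) (Z p)) := fun {X Y} hX hY Z ↦ by
    have h := torsion_eq (D := nab) hX hY p
    rw [hLC.1] at h
    have h' := congr(g.val p $h (Z p))
    simp only [Pi.zero_apply, zero_apply, map_zero, map_sub, sub_apply] at h'
    rw [torsion_eq hX hY p]
    simp only [map_sub, sub_apply]
    linarith
  have sy := g.symm p
  simp only [map_add, map_smul, add_apply, smul_apply, smul_eq_mul]
  have m1 := met hX hY hZ
  have m2 := met hY hZ hX
  have m3 := met hZ hX hY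
  have t1 := tor hX hY Z
  have t2 := tor hY hZ X
  have t3 := tor hZ hX Y
  have e1 := (hT p (X p) (Y p) (Z p)).2
  have e2 := (hT p (X p) (Z p) (Y p)).1
  have e3 := (hT p (Y p) (X p) (Z p)).2
  have e4 := (hT p (X p) (Y p) (Z p)).1
  rw [sy (Y p) , sy (Y p) (nabla nab X Z p)] at m1
  rw [sy (Z p) , sy (Z p) (nabla nab Y X p)] at m2
  rw [sy (X p) , sy (X p) (nabla nab Z Y p)] at m3
  linarith

theorem covDerivTorsion_leviCivita [T2Space M] {nab : Connection E M} {g : PseudoMetric E M}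
    (hLC : IsLeviCivita nab g) (hg : PreservesMetric D g) (hT : HasSkewTorsion D g)
    (hX : SmoothField X) (hY : SmoothField Y) (hZ : SmoothField Z) (hW : SmoothField W) (p : M) :
    covDerivTorsion nab D g X Y Z W p = covDerivTorsion D D g X Y Z W p
      + 2⁻¹ * (torsionSq D g X Y Z W p + torsionSq D g Y Z X W p + torsionSq D g Z X Y W p) := by
  simp only [covDerivTorsion, torsion3, torsionSq,
    nabla_eq_add_half_torsion hLC hg hT hX hY p, nabla_eq_add_half_torsion hLC hg hT hX hZ p,
    nabla_eq_add_half_torsion hLC hg hT hX hW p, map_add, map_smul, add_apply, smul_apply,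
    smul_eq_mul]
  have h₁ := (hT p (Z p) (D.torsion p (X p) (Y p)) (W p)).1
  have h₂ := (hT p (Z p) (W p) (D.torsion p (X p) (Y p))).2
  have h₃ := (hT p (Y p) (D.torsion p (X p) (Z p)) (W p)).2
  have h₄ := g.symm p (D.torsion p (X p) (Y p)) (D.torsion p (Z p) (W p))
  have h₅ := g.symm p (D.torsion p (Z p) (X p)) (D.torsion p (Y p) (W p))
  rw [D.torsion_antisymm (Z p) (X p)] at h₅ ⊢
  simp only [map_neg, neg_apply] at h₅ ⊢
  linarith

end Torsion

/-! ### The pHKT-connection -/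

section PHKT

variable [FiniteDimensional ℝ E] [CompleteSpace E] {D : Connection E M}

/-- For the connection `D = ∇ + T / 2` preserving `J₁`, one has
`2 F₁(x, y, z) = -T(x, J₁ y, z) - T(x, y, J₁ z)`, so the nearly Kähler condition says that `J₁` can
be moved from one argument of `T` to another. -/
theorem metric_torsion_J [T2Space M] {S : AlmostHGStructure E M} {nab : Connection E M}
    (hLC : IsLeviCivita nab S.g) (hJ : PreservesEnd D (S.J 0)) (hg : PreservesMetric D S.g)
    (hT : HasSkewTorsion D S.g) (hN : IsNearlyKahler nab S.g (S.J 0)) (p : M)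
    (u v w : TangentSpace 𝓘(ℝ, E) p) :
    S.g.val p (D.torsion p (S.J 0 p u) v) w = S.g.val p (D.torsion p u (S.J 0 p v)) w := by
  obtain ⟨X, hX, rfl⟩ := exists_smoothField p u
  obtain ⟨Y, hY, rfl⟩ := exists_smoothField p v
  obtain ⟨Z, hZ, rfl⟩ := exists_smoothField p w
  have F : ∀ {X Y : VField E M}, SmoothField X → SmoothField Y →
      2 * structuralTensor nab S.g (S.J 0) X Y Z p
        = -S.g.val p (D.torsion p (X p) (S.J 0 p (Y p))) (Z p)
          - S.g.val p (D.torsion p (X p) (Y p)) (S.J 0 p (Z p)) := fun {X Y} hX hY ↦ by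
    have h1 := nabla_eq_add_half_torsion hLC hg hT hX (hY.J S 0) p
    rw [nabla_J hJ hX hY] at h1
    beta_reduce at h1
    rw [nabla_eq_add_half_torsion hLC hg hT hX hY, ← sub_eq_iff_eq_add] at h1
    simp only [structuralTensor, nablaEnd]
    rw [← h1]
    have h2 := S.g_J_left 0 p (D.torsion p (X p) (Y p)) (Z p)
    simp only [sign, Matrix.cons_val_zero] at h2
    simp only [map_add, map_sub, map_smul, add_apply, sub_apply, smul_apply, smul_eq_mul, h2]
    ring
  have h := hN _ _ _ hX hY hZ p
  have h1 := F hX hY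
  have h2 := F hY hX
  have h3 := (hT p (Y p) (X p) (S.J 0 p (Z p))).1
  have h4 := (hT p (S.J 0 p (X p)) (Y p) (Z p)).1
  linarith

theorem torsion_J [T2Space M] {S : AlmostHGStructure E M} {nab : Connection E M}
    (hLC : IsLeviCivita nab S.g) (hJ : PreservesEnd D (S.J 0)) (hg : PreservesMetric D S.g)
    (hT : HasSkewTorsion D S.g) (hN : IsNearlyKahler nab S.g (S.J 0)) (p : M)
    (u v : TangentSpace 𝓘(ℝ, E) p) :
    D.torsion p (S.J 0 p u) v = -S.J 0 p (D.torsion p u v) := by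
  refine S.g.ext_left fun w ↦ ?_
  have h2 := S.g_J_left 0 p (D.torsion p u v) w
  simp only [sign, Matrix.cons_val_zero] at h2
  have h := metric_torsion_J hLC hJ hg hT hN p
  rw [map_neg, neg_apply, h2]
  linarith [h u v w, (hT p (S.J 0 p v) u w).1, (hT p (S.J 0 p v) u w).2, h v w u,
    (hT p v u (S.J 0 p w)).2, (hT p v u (S.J 0 p w)).1]

/-- The torsion is `D`-parallel, as for the characteristic connection of every nearly Kähler
structure. -/
theorem covDerivTorsion_eq_zero [T2Space M] {S : AlmostHGStructure E M} {nab : Connection E M}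
    (hLC : IsLeviCivita nab S.g) [D.ContMDiffCovariantDerivative ∞]
    (hJ : PreservesEnd D (S.J 0)) (hg : PreservesMetric D S.g)
    (hT : HasSkewTorsion D S.g) (hN : IsNearlyKahler nab S.g (S.J 0)) {X Y Z W : VField E M}
    (hX : SmoothField X) (hY : SmoothField Y) (hZ : SmoothField Z) (hW : SmoothField W) (p : M) :
    covDerivTorsion D D S.g X Y Z W p = 0 := by
  have hTJ := metric_torsion_J hLC hJ hg hT hN
  have hTJ' := torsion_J hLC hJ hg hT hN
  have gJ : ∀ v w, S.g.val p (S.J 0 p v) w = -S.g.val p v (S.J 0 p w) := fun v w ↦ by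
    simpa [sign] using S.g_J_left 0 p v w
  refine covDeriv_torsion_eq_zero (V := {X : VField E M // SmoothField X})
    (K := fun x y z w ↦ S.g.val p (curvature D x y z p) (w.1 p))
    (A := fun x y z w ↦ covDerivTorsion D D S.g x y z w p)
    (q := fun x y z w ↦ torsionSq D S.g x y z w p)
    (J := fun x ↦ ⟨_, x.2.J S 0⟩)
    ?_ ?_ ?_ ?_ ?_ ?_ ?_ ?_ ?_ ?_ ?_ ?_ ?_ ?_ ⟨X, hX⟩ ⟨Y, hY⟩ ⟨Z, hZ⟩ ⟨W, hW⟩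
  · intro x y z w
    rw [curvature_swap, map_neg, neg_apply]
  · exact fun x y z w ↦ metric_curvature_skew hg x.2 y.2 z.2 w.2 p
  · exact fun x y z w ↦ covDerivTorsion_swap₁ hT p
  · exact fun x y z w ↦ covDerivTorsion_swap₂ hT p
  · exact fun x y z w ↦ torsionSq_swap p
  · exact fun x y z w ↦ torsionSq_pair p
  · exact fun x y z w ↦ first_bianchi hg hT x.2 y.2 z.2 w.2 p
  · intro x y z w
    have h := S.g_J 0 p (curvature D x y z p) (w.1 p)
    simp only [sign, Matrix.cons_val_zero, one_mul] at h
    rw [h, ← curvature_J hJ x.2 y.2 z.2]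
  · intro x y z w
    rw [curvature_J hJ x.2 y.2 (z.2.J S 0), curvature_J hJ x.2 y.2 z.2, S.J_sq, map_neg, neg_apply]
  · intro x y z w
    have h : ∀ Y Z W : VField E M, torsion3 D S.g (fun q ↦ S.J 0 q (Y q)) Z W
        = torsion3 D S.g Y (fun q ↦ S.J 0 q (Z q)) W := fun Y Z W ↦ funext fun q ↦ hTJ q _ _ _
    simp only [covDerivTorsion, nabla_J hJ x.2 y.2, nabla_J hJ x.2 z.2, h]
  · intro x y z w
    have h : ∀ Y Z W : VField E M, torsion3 D S.g (fun q ↦ S.J 0 q (S.J 0 q (Y q))) Z W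
        = fun p ↦ -torsion3 D S.g Y Z W p := fun Y Z W ↦ funext fun q ↦ by
      simp only [torsion3, S.J_sq, map_neg, neg_apply]
    simp only [covDerivTorsion, nabla_J hJ x.2 (y.2.J S 0), nabla_J hJ x.2 y.2, h, dirDeriv_neg]
    ring
  · exact fun x y z w ↦ congr(S.g.val p $(S.g.ext_left (hTJ p (x.1 p) (y.1 p))) _)
  · intro x y z w
    simp only [torsionSq, hTJ', map_neg, neg_apply, gJ, neg_neg]
  · intro x y z w
    simp only [torsionSq, S.J_sq, map_neg, neg_apply]

/-- If the curvature of a pHKT-connection satisfies the Bianchi identity of a torsion-free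
connection, it vanishes. -/
theorem metric_curvature_eq_zero [T2Space M] {S : AlmostHGStructure E M}
    [D.ContMDiffCovariantDerivative ∞] (hD : IsPHKT D S) (p : M)
    (hK : ∀ X Y Z W : VField E M, SmoothField X → SmoothField Y → SmoothField Z → SmoothField W →
      S.g.val p (curvature D X Y Z p) (W p) + S.g.val p (curvature D Y Z X p) (W p)
        + S.g.val p (curvature D Z X Y p) (W p) = 0)
    {X Y Z W : VField E M}
    (hX : SmoothField X) (hY : SmoothField Y) (hZ : SmoothField Z) (hW : SmoothField W) :
    S.g.val p (curvature D X Y Z p) (W p) = 0 := by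
  obtain ⟨hJ, hg, hT⟩ := hD
  have norden : ∀ α, sign α = -1 → ∀ x y z w : {X : VField E M // SmoothField X},
      S.g.val p (curvature D x y (fun q ↦ S.J α q (z.1 q)) p) (w.1 p)
        = S.g.val p (curvature D x y z p) (S.J α p (w.1 p)) := fun α hα x y z w ↦ by
    rw [curvature_J (hJ α) x.2 y.2 z.2, S.g_J_left, hα, neg_neg, one_mul]
  refine curvature_eq_zero (V := {X : VField E M // SmoothField X})
    (K := fun x y z w ↦ S.g.val p (curvature D x y z p) (w.1 p))
    (J₁ := fun x ↦ ⟨_, x.2.J S 0⟩) (J₂ := fun x ↦ ⟨_, x.2.J S 1⟩) (J₃ := fun x ↦ ⟨_, x.2.J S 2⟩)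
    ?_ ?_ ?_ ?_ ?_ ?_ ?_ ?_ ?_ ⟨X, hX⟩ ⟨Y, hY⟩ ⟨Z, hZ⟩ ⟨W, hW⟩
  · intro x y z w
    rw [curvature_swap, map_neg, neg_apply]
  · exact fun x y z w ↦ metric_curvature_skew hg x.2 y.2 z.2 w.2 p
  · exact fun x y z w ↦ hK x y z w x.2 y.2 z.2 w.2
  · exact fun x ↦ Subtype.ext (funext fun q ↦ S.J_mul 0 q _)
  · intro x y z w
    have h := S.J_anticomm 0 p (curvature D x y z p)
    rw [← S.J_mul 0] at h
    rw [curvature_J (hJ 2) x.2 y.2 (z.2.J S 1), curvature_J (hJ 1) x.2 y.2 z.2,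
      curvature_J (hJ 0) x.2 y.2 z.2, h, map_neg, neg_apply, neg_neg]
    rfl
  · intro x y z w
    rw [curvature_J (hJ 0) x.2 y.2 (z.2.J S 0), curvature_J (hJ 0) x.2 y.2 z.2, S.J_sq, map_neg,
      neg_apply]
  · intro x y z w
    have h := S.g_J 0 p (curvature D x y z p) (w.1 p)
    simp only [sign, Matrix.cons_val_zero, one_mul] at h
    rw [h, ← curvature_J (hJ 0) x.2 y.2 z.2]
  · exact norden 1 (by simp [sign])
  · exact norden 2 (by simp [sign])

end PHKT

end HGGeometry

open HGGeometry in
theorem theorem18 {E : Type*} [NormedAddCommGroup E] [NormedSpace ℝ E] [FiniteDimensional ℝ E]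
    [CompleteSpace E] {M : Type*} [TopologicalSpace M] [T2Space M] [ChartedSpace E M]
    [IsManifold 𝓘(ℝ, E) ∞ M]
    (S : HGGeometry.AlmostHGStructure E M)
    (nab : HGGeometry.Connection E M) [nab.ContMDiffCovariantDerivative ∞]
    (hLC : HGGeometry.IsLeviCivita nab S.g) (hW : HGGeometry.IsW133 nab S)
    (D : HGGeometry.Connection E M) [D.ContMDiffCovariantDerivative ∞]
    (hD : HGGeometry.IsPHKT D S) :
    [HGGeometry.IsStrong D S.g, HGGeometry.HasParallelTorsion nab D S.g,
      HGGeometry.IsFlat D].TFAE := by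
  obtain ⟨hJ, hg, hT⟩ := id hD
  have A₀ := fun {X Y Z W : VField E M} ↦
    covDerivTorsion_eq_zero (X := X) (Y := Y) (Z := Z) (W := W) hLC (hJ 0) hg hT hW.1
  -- each of the three conditions says that the 4-form `σ` vanishes
  let P : Prop := ∀ X Y Z W : VField E M, SmoothField X → SmoothField Y → SmoothField Z →
    SmoothField W → ∀ p,
      torsionSq D S.g X Y Z W p + torsionSq D S.g Y Z X W p + torsionSq D S.g Z X Y W p = 0
  have strong : IsStrong D S.g ↔ P := by
    refine forall₄_congr fun X Y Z W ↦ forall₅_congr fun hX hY hZ hW p ↦ ?_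
    rw [extDeriv3_torsion3 hT hX hY hZ hW, A₀ hX hY hZ hW, A₀ hY hX hZ hW, A₀ hZ hX hY hW,
      A₀ hW hX hY hZ]
    simp
  have parallel : HasParallelTorsion nab D S.g ↔ P := by
    refine forall₄_congr fun X Y Z W ↦ forall₅_congr fun hX hY hZ hW p ↦ ?_
    change covDerivTorsion nab D S.g X Y Z W p = 0 ↔ _
    rw [covDerivTorsion_leviCivita hLC hg hT hX hY hZ hW, A₀ hX hY hZ hW]
    simp
  have bianchi : ∀ {X Y Z W : VField E M}, SmoothField X → SmoothField Y → SmoothField Z →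
      SmoothField W → ∀ p, _ := fun {X Y Z W} hX hY hZ hW p ↦
    first_bianchi (D := D) hg hT hX hY hZ hW p
  have flat : IsFlat D ↔ P := by
    constructor
    · intro h X Y Z W hX hY hZ hW p
      have b := bianchi hX hY hZ hW p
      rw [h X Y Z hX hY hZ, h Y Z X hY hZ hX, h Z X Y hZ hX hY, A₀ hX hY hZ hW, A₀ hY hZ hX hW,
        A₀ hZ hX hY hW] at b
      simp only [map_zero, zero_apply] at b
      linarith
    · intro h X Y Z hX hY hZ p
      refine S.g.nondegenerate p _ fun w ↦ ?_
      obtain ⟨W, hW, rfl⟩ := exists_smoothField p w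
      refine metric_curvature_eq_zero hD p (fun X Y Z W hX hY hZ hW ↦ ?_) hX hY hZ hW
      rw [bianchi hX hY hZ hW, h X Y Z W hX hY hZ hW, A₀ hX hY hZ hW, A₀ hY hZ hX hW,
        A₀ hZ hX hY hW]
      simp
  tfae_have 1 ↔ 2 := strong.trans parallel.symm
  tfae_have 2 ↔ 3 := parallel.trans flat.symm
  tfae_finish
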